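/- Write $\mathbb R_+=[0,\infty)$ and let $\mathscr L^1$ be the Lebesgue measure on $[0,1]$. A *bounded Lorentzian metric space* is a nonempty set $M$ with a function $\tau\colon M^2\to\mathbb R_+$ such that (a) $\tau(x,y)+\tau(y,z)\le\tau(x,z)$ whenever $\tau(x,y)>0$ and $\tau(y,z)>0$; (b) there is a topology $T$ on $M$ such that, with respect to $T\times T$, $\tau$ is continuous and $\{\tau\ge\varepsilon\}$ is compact for every $\varepsilon>0$; (c) for all $x\ne y$ in $M$ there is $z\in M$ with $\tau(x,z)\ne\tau(y,z)$ or $\tau(z,x)\neq\tau(z,y)$. It is endowed with the coarsest topology as in (b) (which exists) and its Borel $\sigma$-algebra. A *normalized bounded Lorentzian metric measure space* is a triple $\mathscr M=(M,\tau,\mathfrak m)$ of such a space and a Borel probability measure $\mathfrak m$ on it. Let $q\colon \operatorname{supp}\mathfrak m\to\tilde M$ be the projection onto the distance quotient of $\operatorname{supp}\mathfrak m$, obtained by identifying $x,y\in\operatorname{supp}\mathfrak m$ if $\tau(x,z)=\tau(y,z)$ and $\tau(z,x)=\tau(z,y)$ for every $z\in\operatorname{supp}\mathfrak m$, with the induced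 function $\tilde\tau$. Let $\tilde M\cup\{i^0\}$ denote $\tilde M$ itself if $\tilde M$ contains a point $i^0$ with $\tilde\tau(i^0,\cdot)=\tilde\tau(\cdot,i^0)=0$, and otherwise $\tilde M$ with one further point $i^0$ adjoined, where $\tilde\tau$ is extended by $0$; this is again a bounded Lorentzian metric space. Two normalized bounded Lorentzian metric measure spaces $\mathscr M,\mathscr M'$ are *isomorphic* if there is a Borel measurable map $\iota\colon\tilde M\cup\{i^0\}\to\tilde M'\cup\{i'^0\}$ with $\tilde\tau(x,y)=\tilde\tau'(\iota(x),\iota(y))$ for all $x,y$ and $\iota_\sharp(q_\sharp\mathfrak m)=q'_\sharp\mathfrak m'$. A *parametrization* of $\mathscr M$ is a Borel measurable map $\psi\colon[0,1]\to M$ with $\psi_\sharp\mathscr L^1=\mathfrak m$; let $\operatorname{Par}\mathscr M$ be the set of all parametrizations and $\psi^*\tau(s,t):=\tau(\psi(s),\psi(t))$. For Borel functions $u,v\colon[0,1]^2\to\mathbb R_+$, let $$\square(u,v):=\inf\{\varepsilon>0:\ \text{there is a Borel set }Q\subset[0,1]\text{ with }\mathscr L^1[Q]\le\varepsilon\text{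 and }|u-v|\le\varepsilon\text{ on }([0,1]\setminus Q)^2\},$$ and define the *Lorentz–Gromov box distance* $$\mathsf L\square(\mathscr M,\mathscr M'):=\inf\{\square(\psi^*\tau,\psi'^*\tau'):\ \psi\in\operatorname{Par}\mathscr M,\ \psi'\in\operatorname{Par}\mathscr M'\}.$$ **Theorem.** Every normalized bounded Lorentzian metric measure space admits a parametrization, isomorphy is an equivalence relation on normalized bounded Lorentzian metric measure spaces, and $\mathsf L\square([\mathscr M],[\mathscr M']):=\mathsf L\square(\mathscr M,\mathscr M')$ constitutes a well-defined metric on the set $\mathbf M_1$ of isomorphism classes of normalized bounded Lorentzian metric measure spaces. That is, $\mathsf L\square(\mathscr M,\mathscr M')$ depends only on the isomorphism classes of $\mathscr M$ and $\mathscr M'$, is finite, nonnegative and symmetric, satisfies the triangle inequality, and vanishes if and only if $\mathscr M$ and $\mathscr M'$ are isomorphic. -/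

import Mathlib

universe u

noncomputable section

namespace LorentzBox

open Set Filter Topology MeasureTheory

/-! ### Time separation functions and their topology -/

/-- A topology `T` is admissible for `τ` if, with respect to the product topology `T × T`,
`τ` is continuous and all superlevel sets `{τ ≥ ε}`, `ε > 0`, are compact. -/
def Admissible {X : Type u} (τ : X → X → ℝ) (T : TopologicalSpace X) : Prop :=
  letI := T
  Continuous (fun p : X × X => τ p.1 p.2) ∧
    ∀ ε : ℝ, 0 < ε → IsCompact {p : X × X | ε ≤ τ p.1 p.2}

/-- The coarsest admissible topology. In Mathlib's order on topologies, finer topologies are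
smaller, so the coarsest topology of a family is its greatest element;
see `coarsestTopology_isGreatest`. -/
@[reducible] def coarsestTopology {X : Type u} (τ : X → X → ℝ) : TopologicalSpace X :=
  sSup {T | Admissible τ T}

/-- The axioms of a bounded Lorentzian metric space other than non-emptiness and the point
distinction property: nonnegativity, the reverse triangle inequality along chronologically
related triples, and continuity of `τ` with compact superlevel sets in some topology. -/
structure IsTimeSeparation {X : Type u} (τ : X → X → ℝ) : Prop where
  nonneg : ∀ x y, 0 ≤ τ x y
  reverse_triangle : ∀ x y z, 0 < τ x y → 0 < τ y z → τ x y + τ y z ≤ τ x z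
  exists_admissible : ∃ T, Admissible τ T

/-- The initial topology of all functions `τ(·, z)` and `τ(z, ·)`. -/
@[reducible] def initialTopology {X : Type u} (τ : X → X → ℝ) : TopologicalSpace X :=
  TopologicalSpace.induced (fun x z => (τ x z, τ z x)) inferInstance

theorem Admissible.le_initialTopology {X : Type u} {τ : X → X → ℝ} {T : TopologicalSpace X}
    (h : Admissible τ T) : T ≤ initialTopology τ := by
  have hc : Continuous (fun p : X × X => τ p.1 p.2) := h.1
  refine continuous_iff_le_induced.1 (continuous_pi fun z => ?_)
  exact (hc.comp (continuous_id.prodMk continuous_const)).prodMk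
    (hc.comp (continuous_const.prodMk continuous_id))

theorem tendsto_of_initialTopology {X : Type u} {τ : X → X → ℝ} {l : Filter X} {x : X}
    (h : l ≤ @nhds X (initialTopology τ) x) (z : X) :
    Tendsto (fun y => τ y z) l (𝓝 (τ x z)) ∧ Tendsto (fun y => τ z y) l (𝓝 (τ z x)) := by
  let := initialTopology τ
  have hc : Continuous (fun x : X => fun z => (τ x z, τ z x)) := continuous_induced_dom
  have := ((continuous_apply z).comp hc).tendsto x |>.mono_left h
  exact ⟨(continuous_fst.tendsto _).comp this, (continuous_snd.tendsto _).comp this⟩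

theorem Admissible.initialTopology {X : Type u} {τ : X → X → ℝ} {T : TopologicalSpace X}
    (hnn : ∀ x y, 0 ≤ τ x y) (h : Admissible τ T) : Admissible τ (initialTopology τ) := by
  have hle := h.le_initialTopology
  obtain ⟨hc, hK⟩ := h
  have key : ∀ (x y : X) (U : Ultrafilter (X × X)),
      Tendsto Prod.fst (U : Filter (X × X)) (@nhds X (LorentzBox.initialTopology τ) x) →
      Tendsto Prod.snd (U : Filter (X × X)) (@nhds X (LorentzBox.initialTopology τ) y) →
      Tendsto (fun p : X × X => τ p.1 p.2) U (𝓝 (τ x y)) := by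
    intro x y U h1 h2
    -- a limit in `T` of both components gives the claim
    have lim : ∀ x' y' : X, Tendsto Prod.fst (U : Filter (X × X)) (@nhds X T x') →
        Tendsto Prod.snd (U : Filter (X × X)) (@nhds X T y') →
        Tendsto (fun p : X × X => τ p.1 p.2) U (𝓝 (τ x y)) := by
      intro x' y' g1 g2
      have e1 : τ x' y' = τ x y' := by
        have a := (tendsto_of_initialTopology (g1.mono_right (nhds_mono hle)) y').1
        have b := (tendsto_of_initialTopology h1 y').1
        have a' : Tendsto (fun p : X × X => τ p.1 y') U (𝓝 (τ x' y')) :=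
            tendsto_map'_iff.1 a
        have b' : Tendsto (fun p : X × X => τ p.1 y') U (𝓝 (τ x y')) :=
            tendsto_map'_iff.1 b
        exact tendsto_nhds_unique a' b'
      have e2 : τ x y' = τ x y := by
        have a := (tendsto_of_initialTopology (g2.mono_right (nhds_mono hle)) x).2
        have b := (tendsto_of_initialTopology h2 x).2
        have a' : Tendsto (fun p : X × X => τ x p.2) U (𝓝 (τ x y')) :=
            tendsto_map'_iff.1 a
        have b' : Tendsto (fun p : X × X => τ x p.2) U (𝓝 (τ x y)) :=
            tendsto_map'_iff.1 b
        exact tendsto_nhds_unique a' b'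
      have g : (U : Filter (X × X)) ≤ 𝓝 (x', y') := by
        rw [nhds_prod_eq]; exact g1.prodMk g2
      rw [← e2, ← e1]
      exact (hc.tendsto (x', y')).mono_left g
    -- an ultrafilter containing a superlevel set converges in `T × T`
    by_cases hlev : ∃ ε : ℝ, 0 < ε ∧ {p : X × X | ε ≤ τ p.1 p.2} ∈ U
    · obtain ⟨ε, hε, hU⟩ := hlev
      obtain ⟨⟨x', y'⟩, -, hp⟩ := (hK ε hε).ultrafilter_le_nhds' U hU
      exact lim x' y' ((continuous_fst.tendsto (x', y')).mono_left hp)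
        ((continuous_snd.tendsto (x', y')).mono_left hp)
    · by_cases hxy : τ x y = 0
      · rw [hxy, Metric.tendsto_nhds]
        intro ε hε
        by_contra hcon
        refine hlev ⟨ε, hε, ?_⟩
        have := (Ultrafilter.eventually_not (f := U)).2 hcon
        filter_upwards [this] with p hp
        simpa [abs_of_nonneg (hnn _ _)] using hp
      · have hpos : 0 < τ x y := lt_of_le_of_ne (hnn x y) (Ne.symm hxy)
        have a := (tendsto_of_initialTopology h1 y).1
        have b := (tendsto_of_initialTopology h2 x).2
        have a' : ∀ᶠ p : X × X in U, τ x y / 2 ≤ τ p.1 y :=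
          eventually_map.1 (a.eventually (eventually_ge_nhds (half_lt_self hpos)))
        have b' : ∀ᶠ p : X × X in U, τ x y / 2 ≤ τ x p.2 :=
          eventually_map.1 (b.eventually (eventually_ge_nhds (half_lt_self hpos)))
        have hK' := hK (τ x y / 2) (half_pos hpos)
        obtain ⟨x', -, hx'⟩ := (hK'.image continuous_fst).ultrafilter_le_nhds'
          (U.map Prod.fst) (by
            rw [Ultrafilter.mem_map]
            filter_upwards [a'] with p hp using ⟨(p.1, y), hp, rfl⟩)
        obtain ⟨y', -, hy'⟩ := (hK'.image continuous_snd).ultrafilter_le_nhds'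
          (U.map Prod.snd) (by
            rw [Ultrafilter.mem_map]
            filter_upwards [b'] with p hp using ⟨(x, p.2), hp, rfl⟩)
        exact lim x' y' hx' hy'
  refine ⟨?_, fun ε hε => ?_⟩
  · let := LorentzBox.initialTopology τ
    rw [continuous_iff_ultrafilter]
    intro p U hU
    exact key p.1 p.2 U ((continuous_fst.tendsto p).mono_left hU)
      ((continuous_snd.tendsto p).mono_left hU)
  · have hid := continuous_id_iff_le.2 hle
    have hid2 := @Continuous.prodMap _ _ _ _ (LorentzBox.initialTopology τ)
      (LorentzBox.initialTopology τ) T T _ _ hid hid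
    have := @IsCompact.image _ _ (@instTopologicalSpaceProd X X T T) (@instTopologicalSpaceProd X X
      (LorentzBox.initialTopology τ) (LorentzBox.initialTopology τ)) _ _ (hK ε hε) hid2
    simpa only [Prod.map_id, image_id] using this

theorem IsTimeSeparation.coarsestTopology_eq {X : Type u} {τ : X → X → ℝ}
    (h : IsTimeSeparation τ) : coarsestTopology τ = initialTopology τ := by
  obtain ⟨T, hT⟩ := h.exists_admissible
  exact le_antisymm (sSup_le fun _ h' => h'.le_initialTopology)
    (le_sSup (hT.initialTopology h.nonneg))

/-- The coarsest admissible topology exists. -/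
theorem coarsestTopology_isGreatest {X : Type u} {τ : X → X → ℝ} (h : IsTimeSeparation τ) :
    IsGreatest {T | Admissible τ T} (coarsestTopology τ) := by
  obtain ⟨T, hT⟩ := h.exists_admissible
  refine ⟨?_, fun _ h' => le_sSup h'⟩
  rw [h.coarsestTopology_eq]
  exact hT.initialTopology h.nonneg

/-! ### Constructions with time separation functions -/

/-- Extension of `τ` by zero to one additional point `none`. -/
def extendZero {X : Type u} (τ : X → X → ℝ) : Option X → Option X → ℝ
  | some x, some y => τ x y
  | _, _ => 0

/-- Two points are indistinguishable if they have the same time separation, in both time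
directions, to every point. -/
def indist {X : Type u} (τ : X → X → ℝ) : Setoid X where
  r x y := ∀ z, τ x z = τ y z ∧ τ z x = τ z y
  iseqv := ⟨fun _ _ => ⟨rfl, rfl⟩, fun h z => ⟨(h z).1.symm, (h z).2.symm⟩,
    fun h h' z => ⟨(h z).1.trans (h' z).1, (h z).2.trans (h' z).2⟩⟩

/-- The distance quotient of `(X, τ)`: indistinguishable points are identified. -/
def DistQuot {X : Type u} (τ : X → X → ℝ) : Type u := Quotient (indist τ)

/-- The canonical projection onto the distance quotient. -/
def DistQuot.mk {X : Type u} (τ : X → X → ℝ) (x : X) : DistQuot τ := Quotient.mk (indist τ) x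

/-- The time separation function of the distance quotient. -/
def DistQuot.sep {X : Type u} (τ : X → X → ℝ) : DistQuot τ → DistQuot τ → ℝ :=
  Quotient.lift₂ (s₁ := indist τ) (s₂ := indist τ) τ
    (fun _ _ c _ h h' => ((h _).1).trans (h' c).2)

theorem DistQuot.sep_mk {X : Type u} (τ : X → X → ℝ) (x y : X) :
    DistQuot.sep τ (DistQuot.mk τ x) (DistQuot.mk τ y) = τ x y := rfl

theorem DistQuot.mk_surjective {X : Type u} (τ : X → X → ℝ) :
    Function.Surjective (DistQuot.mk τ) := Quotient.mk_surjective

theorem IsTimeSeparation.restrict {X : Type u} {τ : X → X → ℝ} (h : IsTimeSeparation τ)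
    {S : Set X} (hS : @IsClosed X (coarsestTopology τ) S) :
    IsTimeSeparation (fun x y : S => τ x y) := by
  refine ⟨fun _ _ => h.nonneg _ _, fun _ _ _ => h.reverse_triangle _ _ _, ?_⟩
  obtain ⟨hc, hK⟩ := (coarsestTopology_isGreatest h).1
  let := coarsestTopology τ
  refine ⟨inferInstance, ?_, fun ε hε => ?_⟩
  · exact hc.comp (continuous_subtype_val.prodMap continuous_subtype_val)
  · have he : IsClosedEmbedding (Prod.map ((↑) : S → X) ((↑) : S → X)) :=
      hS.isClosedEmbedding_subtypeVal.prodMap hS.isClosedEmbedding_subtypeVal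
    exact he.isCompact_preimage (hK ε hε)

theorem IsTimeSeparation.extendZero {X : Type u} {τ : X → X → ℝ} (h : IsTimeSeparation τ) :
    IsTimeSeparation (extendZero τ) := by
  refine ⟨?_, ?_, ?_⟩
  · rintro (_ | x) (_ | y) <;> simp [LorentzBox.extendZero, h.nonneg]
  · rintro (_ | x) (_ | y) (_ | z) <;> simp [LorentzBox.extendZero]
    exact h.reverse_triangle x y z
  · obtain ⟨T, hc, hK⟩ := h.exists_admissible
    let : TopologicalSpace (Option X) := TopologicalSpace.coinduced some T
    have hsome : IsOpenEmbedding (some : X → Option X) := by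
      refine .of_continuous_injective_isOpenMap continuous_coinduced_rng
        (Option.some_injective X) fun U hU => ?_
      refine isOpen_coinduced.2 ?_
      rwa [preimage_image_eq _ (Option.some_injective X)]
    have hnone : IsOpen ({none} : Set (Option X)) := by
      refine isOpen_coinduced.2 ?_
      have : (some : X → Option X) ⁻¹' {none} = ∅ := by ext; simp
      rw [this]; exact isOpen_empty
    refine ⟨inferInstance, ?_, fun ε hε => ?_⟩
    · rw [continuous_iff_continuousAt]
      have hn : 𝓝 (none : Option X) = pure none :=
        (isOpen_singleton_iff_nhds_eq_pure _).1 hnone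
      have hz1 : ∀ y : Option X, LorentzBox.extendZero τ none y = 0 := by
        rintro (_ | _) <;> rfl
      have hz2 : ∀ y : Option X, LorentzBox.extendZero τ y none = 0 := by
        rintro (_ | _) <;> rfl
      rintro ⟨_ | x, y⟩
      · have : (fun p : Option X × Option X => LorentzBox.extendZero τ p.1 p.2)
            =ᶠ[𝓝 (none, y)] fun _ => 0 := by
          have : Prod.fst ⁻¹' {(none : Option X)} ∈ 𝓝 ((none : Option X), y) :=
            (hnone.preimage continuous_fst).mem_nhds rfl
          filter_upwards [this] with p hp
          rw [show p.1 = none from hp, hz1]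
        exact continuousAt_const.congr this.symm
      · rcases y with _ | y
        · have : (fun p : Option X × Option X => LorentzBox.extendZero τ p.1 p.2)
              =ᶠ[𝓝 (some x, none)] fun _ => 0 := by
            have : Prod.snd ⁻¹' {(none : Option X)} ∈ 𝓝 (some x, (none : Option X)) :=
              (hnone.preimage continuous_snd).mem_nhds rfl
            filter_upwards [this] with p hp
            rw [show p.2 = none from hp, hz2]
          exact continuousAt_const.congr this.symm
        · have := (hsome.prodMap hsome).continuousAt_iff
            (g := fun p : Option X × Option X => LorentzBox.extendZero τ p.1 p.2) (x := (x, y))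
          exact this.1 hc.continuousAt
    · have := (hK ε hε).image (hsome.continuous.prodMap hsome.continuous)
      convert this using 1
      ext ⟨_ | x, _ | y⟩ <;> simp [LorentzBox.extendZero, hε]

theorem DistQuot.isInducing_mk {X : Type u} (τ : X → X → ℝ) :
    @IsInducing _ _ (initialTopology τ) (initialTopology (DistQuot.sep τ)) (DistQuot.mk τ) := by
  let := initialTopology τ
  let := initialTopology (DistQuot.sep τ)
  refine ⟨le_antisymm ?_ ?_⟩
  · rw [← continuous_iff_le_induced]
    refine continuous_induced_rng.2 (continuous_pi fun z => ?_)
    obtain ⟨z, rfl⟩ := DistQuot.mk_surjective τ z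
    exact (continuous_apply z).comp
      (continuous_induced_dom : Continuous (fun x : X => fun z => (τ x z, τ z x)))
  · have h1 := @continuous_induced_dom _ _ (DistQuot.mk τ) (initialTopology (DistQuot.sep τ))
    have h2 : Continuous (fun x : DistQuot τ => fun z =>
      (DistQuot.sep τ x z, DistQuot.sep τ z x)) := continuous_induced_dom
    refine continuous_iff_le_induced.1 (@continuous_pi _ _ _ (_) _ _ fun z => ?_)
    exact @Continuous.comp _ _ _ (_) _ _ _ _
      ((continuous_apply (DistQuot.mk τ z)).comp h2) h1

theorem IsTimeSeparation.distQuot {X : Type u} {τ : X → X → ℝ} (h : IsTimeSeparation τ) :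
    IsTimeSeparation (DistQuot.sep τ) := by
  refine ⟨?_, ?_, ?_⟩
  · rintro ⟨x⟩ ⟨y⟩; exact h.nonneg x y
  · rintro ⟨x⟩ ⟨y⟩ ⟨z⟩; exact h.reverse_triangle x y z
  · obtain ⟨T, hT⟩ := h.exists_admissible
    obtain ⟨hc, hK⟩ := hT.initialTopology h.nonneg
    let := initialTopology τ
    let := initialTopology (DistQuot.sep τ)
    have hq : IsInducing (DistQuot.mk τ) := DistQuot.isInducing_mk τ
    have hqq : IsInducing (Prod.map (DistQuot.mk τ) (DistQuot.mk τ)) := hq.prodMap hq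
    have hs : Function.Surjective (Prod.map (DistQuot.mk τ) (DistQuot.mk τ)) :=
      (DistQuot.mk_surjective τ).prodMap (DistQuot.mk_surjective τ)
    have hquot : IsQuotientMap (Prod.map (DistQuot.mk τ) (DistQuot.mk τ)) :=
      (hqq.isOpenMap (by rw [hs.range_eq]; exact isOpen_univ)).isQuotientMap hqq.continuous hs
    refine ⟨inferInstance, hquot.continuous_iff.2 hc, fun ε hε => ?_⟩
    have := (hK ε hε).image hqq.continuous
    convert this using 1
    ext p
    obtain ⟨⟨x, y⟩, rfl⟩ := hs p
    constructor
    · intro hp; exact ⟨(x, y), hp, rfl⟩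
    · rintro ⟨⟨x', y'⟩, hp, he⟩
      rw [← he]; exact hp

/-! ### Bounded Lorentzian metric (measure) spaces -/

/-- A bounded Lorentzian metric space. -/
structure BLSpace where
  carrier : Type u
  nonempty : Nonempty carrier
  τ : carrier → carrier → ℝ
  isTimeSeparation : IsTimeSeparation τ
  distinguishes : ∀ x y, x ≠ y → ∃ z, τ x z ≠ τ y z ∨ τ z x ≠ τ z y

instance : CoeSort BLSpace.{u} (Type u) := ⟨BLSpace.carrier⟩

instance (X : BLSpace.{u}) : TopologicalSpace X := coarsestTopology X.τ

instance (X : BLSpace.{u}) : MeasurableSpace X := borel X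

instance (X : BLSpace.{u}) : BorelSpace X := ⟨rfl⟩

/-- A normalized bounded Lorentzian metric measure space: a bounded Lorentzian metric space
with a Borel probability measure, whose support may be smaller than the space. -/
structure NormalizedBLMMS where
  space : BLSpace.{u}
  m : Measure space
  isProbabilityMeasure : IsProbabilityMeasure m

namespace NormalizedBLMMS

variable (M : NormalizedBLMMS.{u})

/-- The time separation function on `supp m ∪ {i⁰}`, where the adjoined point `i⁰ = none` has
zero time separation to and from all points. -/
def suppSep : Option M.m.support → Option M.m.support → ℝ :=
  extendZero (fun x y : M.m.support => M.space.τ x y)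

theorem isTimeSeparation_suppSep : IsTimeSeparation M.suppSep :=
  (M.space.isTimeSeparation.restrict M.m.isClosed_support).extendZero

/-- The distance quotient of `supp m` together with its spacelike boundary `i⁰`. Points of
`supp m` are identified iff they are indistinguishable within `supp m`
(`mk_some_eq_mk_some`). The adjoined point is the spacelike boundary of the distance quotient
of `supp m` if the latter has one, and is an additional point otherwise
(`mk_none_eq_mk_some`). -/
def bdQuot : BLSpace.{u} where
  carrier := DistQuot M.suppSep
  nonempty := ⟨DistQuot.mk _ none⟩
  τ := DistQuot.sep M.suppSep
  isTimeSeparation := M.isTimeSeparation_suppSep.distQuot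
  distinguishes := by
    rintro ⟨x⟩ ⟨y⟩ hxy
    by_contra hcon
    push Not at hcon
    exact hxy (Quotient.sound fun z => hcon (DistQuot.mk _ z))

theorem mk_some_eq_mk_some (x y : M.m.support) :
    DistQuot.mk M.suppSep (some x) = DistQuot.mk M.suppSep (some y) ↔
      ∀ z : M.m.support, M.space.τ x z = M.space.τ y z ∧ M.space.τ z x = M.space.τ z y := by
  refine ⟨fun h z => (Quotient.exact h) (some z), fun h => Quotient.sound ?_⟩
  rintro (_ | z)
  · exact ⟨rfl, rfl⟩
  · exact h z

theorem mk_none_eq_mk_some (x : M.m.support) :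
    DistQuot.mk M.suppSep none = DistQuot.mk M.suppSep (some x) ↔
      ∀ z : M.m.support, M.space.τ x z = 0 ∧ M.space.τ z x = 0 := by
  refine ⟨fun h z => ?_, fun h => Quotient.sound ?_⟩
  · have := (Quotient.exact h) (some z)
    exact ⟨this.1.symm, this.2.symm⟩
  · rintro (_ | z)
    · exact ⟨rfl, rfl⟩
    · exact ⟨(h z).1.symm, (h z).2.symm⟩

/-- The canonical projection of `supp m` to its distance quotient. -/
def proj (x : M.m.support) : M.bdQuot := DistQuot.mk M.suppSep (some x)

theorem continuous_proj : Continuous M.proj := by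
  have e : (inferInstance : TopologicalSpace M.bdQuot) = initialTopology M.bdQuot.τ :=
    M.bdQuot.isTimeSeparation.coarsestTopology_eq
  have hc : Continuous (fun p : M.space × M.space => M.space.τ p.1 p.2) :=
    (coarsestTopology_isGreatest M.space.isTimeSeparation).1.1
  have h : Continuous (fun x : M.m.support => fun z : M.bdQuot.carrier =>
      (M.bdQuot.τ (M.proj x) z, M.bdQuot.τ z (M.proj x))) := by
    refine continuous_pi fun z => ?_
    obtain ⟨_ | z, rfl⟩ := DistQuot.mk_surjective M.suppSep z
    · exact (continuous_const : Continuous fun _ : M.m.support => ((0 : ℝ), (0 : ℝ)))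
    · have h1 : Continuous fun x : M.m.support => M.space.τ x z :=
        hc.comp (continuous_subtype_val.prodMk continuous_const)
      have h2 : Continuous fun x : M.m.support => M.space.τ z x :=
        hc.comp (continuous_const.prodMk continuous_subtype_val)
      exact h1.prodMk h2
  have : @Continuous _ _ _ (initialTopology M.bdQuot.τ) M.proj := continuous_induced_rng.2 h
  rw [← e] at this
  exact this

theorem measurable_proj : Measurable M.proj := M.continuous_proj.measurable

/-- The push-forward under the canonical projection of the restriction of `m` to `supp m`. -/
def quotMeasure : Measure M.bdQuot := (M.m.comap ((↑) : M.m.support → M.space)).map M.proj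

/-- Isomorphy: existence of a Borel measurable, distance-preserving map between the distance
quotients of the supports, with spacelike boundaries included, which pushes the quotient
measure of the first space to that of the second. The projection of `supp m` to its distance
quotient is continuous and onto, so the support of the push-forward of `m` is the whole distance
quotient of `supp m`, and the domain of `ι` is this support together with `i⁰`. -/
def Isomorphic (M M' : NormalizedBLMMS.{u}) : Prop :=
  ∃ ι : M.bdQuot → M'.bdQuot, Measurable ι ∧
    (∀ x y, M.bdQuot.τ x y = M'.bdQuot.τ (ι x) (ι y)) ∧
    M.quotMeasure.map ι = M'.quotMeasure

/-- Parametrizations of `M`: Borel measurable maps `[0,1] → M` pushing forward the Lebesgue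
measure to `m`. -/
def Par : Set (unitInterval → M.space) := {ψ | Measurable ψ ∧ (volume : Measure unitInterval).map ψ = M.m}

end NormalizedBLMMS

/-! ### The box distance -/

/-- The box discrepancy of two functions on `[0,1]²`. -/
def box (u v : unitInterval → unitInterval → ℝ) : ℝ :=
  sInf {ε : ℝ | 0 < ε ∧ ∃ Q : Set unitInterval, MeasurableSet Q ∧ volume Q ≤ ENNReal.ofReal ε ∧
    ∀ s ∉ Q, ∀ t ∉ Q, |u s t - v s t| ≤ ε}

/-- The pull-back of `τ` along a map from the unit interval. -/
def pullback {X : Type u} (τ : X → X → ℝ) (ψ : unitInterval → X) : unitInterval → unitInterval → ℝ := fun s t => τ (ψ s) (ψ t)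

/-- The Lorentz–Gromov box distance. -/
def LBox (M M' : NormalizedBLMMS.{u}) : ℝ :=
  sInf {r : ℝ | ∃ ψ ∈ M.Par, ∃ ψ' ∈ M'.Par,
    r = box (pullback M.space.τ ψ) (pullback M'.space.τ ψ')}

end LorentzBox

end

noncomputable section

namespace LorentzBox

open Set Filter Topology MeasureTheory

/-! ### Topology of bounded Lorentzian metric spaces -/

/-! Adjoining the spacelike boundary turns a bounded Lorentzian metric space into a compact
metrizable one, and the space sits in this completion as a Borel subset. Its Borel probability
measures are therefore images of Lebesgue measure, which gives parametrizations (`Par_nonempty`).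

The triangle inequality rests on gluing: two parametrizations of the middle space have the same law,
so they agree almost everywhere after measure preserving reparametrizations
(`exists_measurePreserving_comp_ae_eq`). The same gluing, applied in the distance quotient, shows
that isomorphic spaces have distance zero.

Conversely, if the distance vanishes, almost optimal parametrizations induce couplings of the
quotient measures on a compact product. A weak limit has a support on which the two time separations
coincide exactly (`exists_coupling`). Since this support projects onto both distance quotients and
points are distinguished by their separations, it is, together with the pair of boundaries, the
graph of an isomorphism. Thus isomorphy is the relation of having distance zero, hence an
equivalence relation, and the distance descends to classes. -/

theorem nhds_initialTopology_le {X : Type u} {τ : X → X → ℝ} {l : Filter X} {x : X}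
    (h : ∀ z, Tendsto (fun y => τ y z) l (𝓝 (τ x z)) ∧ Tendsto (fun y => τ z y) l (𝓝 (τ z x))) :
    l ≤ @nhds X (initialTopology τ) x := by
  rw [nhds_induced, ← tendsto_iff_comap, tendsto_pi_nhds]
  exact fun z => (h z).1.prodMk_nhds (h z).2

/-- A bounded Lorentzian metric space with a spacelike boundary point is compact. -/
theorem IsTimeSeparation.compactSpace {X : Type u} {τ : X → X → ℝ} (h : IsTimeSeparation τ)
    {o : X} (ho : ∀ z, τ o z = 0 ∧ τ z o = 0) : @CompactSpace X (initialTopology τ) := by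
  obtain ⟨T, hT⟩ := h.exists_admissible
  obtain ⟨-, hK⟩ := hT.initialTopology h.nonneg
  let := initialTopology τ
  refine ⟨isCompact_iff_ultrafilter_le_nhds'.2 fun U _ => ?_⟩
  -- Either `U` contains a projection of a compact superlevel set, or all separations tend to zero
  -- along `U`, which is convergence to `o`.
  by_cases hfar : ∃ ε : ℝ, 0 < ε ∧ ((∃ᶠ x in (U : Filter X), ∃ z, ε ≤ τ x z) ∨
      ∃ᶠ x in (U : Filter X), ∃ z, ε ≤ τ z x)
  · obtain ⟨ε, hε, hU | hU⟩ := hfar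
    · obtain ⟨x, -, hx⟩ := ((hK ε hε).image continuous_fst).ultrafilter_le_nhds' U (by
        filter_upwards [Ultrafilter.frequently_iff_eventually.1 hU] with x ⟨z, hz⟩
          using ⟨(x, z), hz, rfl⟩)
      exact ⟨x, mem_univ _, hx⟩
    · obtain ⟨x, -, hx⟩ := ((hK ε hε).image continuous_snd).ultrafilter_le_nhds' U (by
        filter_upwards [Ultrafilter.frequently_iff_eventually.1 hU] with x ⟨z, hz⟩
          using ⟨(z, x), hz, rfl⟩)
      exact ⟨x, mem_univ _, hx⟩
  · push Not at hfar
    refine ⟨o, mem_univ _, nhds_initialTopology_le fun z => ?_⟩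
    rw [(ho z).1, (ho z).2, Metric.tendsto_nhds, Metric.tendsto_nhds]
    refine ⟨fun ε hε => ?_, fun ε hε => ?_⟩
    · filter_upwards [(hfar ε hε).1] with x hx
      simpa [abs_of_nonneg (h.nonneg _ _)] using hx z
    · filter_upwards [(hfar ε hε).2] with x hx
      simpa [abs_of_nonneg (h.nonneg _ _)] using hx z

namespace BLSpace

variable (X : BLSpace.{u})

theorem topology_eq : (inferInstance : TopologicalSpace X) = initialTopology X.τ :=
  X.isTimeSeparation.coarsestTopology_eq

theorem continuous_τ : Continuous (fun p : X × X => X.τ p.1 p.2) :=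
  (coarsestTopology_isGreatest X.isTimeSeparation).1.1

variable {X} in
theorem ext_τ {x y : X} (h : ∀ z, X.τ x z = X.τ y z ∧ X.τ z x = X.τ z y) : x = y := by
  by_contra hne
  obtain ⟨z, hz⟩ := X.distinguishes x y hne
  exact hz.elim (fun h' => h' (h z).1) (fun h' => h' (h z).2)

/-- The map sending a point to its time separations, in both directions, to all points. -/
def sepMap : C(X, C(X, ℝ × ℝ)) :=
  ContinuousMap.curry ⟨fun p : X × X => (X.τ p.1 p.2, X.τ p.2 p.1),
    X.continuous_τ.prodMk (X.continuous_τ.comp continuous_swap)⟩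

theorem sepMap_injective : Function.Injective X.sepMap := by
  intro x y h
  refine ext_τ fun z => ?_
  have := DFunLike.congr_fun h z
  exact Prod.mk.inj this

instance : T2Space X := T2Space.of_injective_continuous X.sepMap_injective X.sepMap.continuous

/-- On a compact space the target of `sepMap` carries the uniform metric, and a continuous injection
from a compact space into a Hausdorff space is an embedding. -/
theorem metrizableSpace [CompactSpace X] : TopologicalSpace.MetrizableSpace X :=
  (X.sepMap.continuous.isClosedEmbedding X.sepMap_injective).isEmbedding.metrizableSpace

theorem secondCountableTopology [CompactSpace X] : SecondCountableTopology X := by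
  have := X.metrizableSpace
  let := TopologicalSpace.metrizableSpaceMetric X
  infer_instance

/-- The topology of `Y` is generated by separations to its points; by surjectivity each of these
points is an image, so the composites are separations in `X`. -/
theorem continuous_of_preserves {Y : BLSpace.{u}} {f : X → Y} (hf : Function.Surjective f)
    (h : ∀ x y, X.τ x y = Y.τ (f x) (f y)) : Continuous f := by
  have : @Continuous _ _ _ (initialTopology Y.τ) f := by
    refine continuous_induced_rng.2 (continuous_pi fun z => ?_)
    obtain ⟨z, rfl⟩ := hf z
    simp only [Function.comp_def, ← h]
    exact (X.continuous_τ.comp (continuous_id.prodMk continuous_const)).prodMk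
      (X.continuous_τ.comp (continuous_const.prodMk continuous_id))
  rw [← Y.topology_eq] at this
  exact this

end BLSpace

/-! ### The compact completion. -/

/-- The distance quotient of `X` together with its spacelike boundary. -/
def completion {X : Type u} {τ : X → X → ℝ} (h : IsTimeSeparation τ) : BLSpace.{u} where
  carrier := DistQuot (extendZero τ)
  nonempty := ⟨DistQuot.mk _ none⟩
  τ := DistQuot.sep (extendZero τ)
  isTimeSeparation := h.extendZero.distQuot
  distinguishes := by
    rintro ⟨x⟩ ⟨y⟩ hxy
    by_contra hcon
    push Not at hcon
    exact hxy (Quotient.sound fun z => hcon (DistQuot.mk _ z))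

namespace completion

variable {X : Type u} {τ : X → X → ℝ} (h : IsTimeSeparation τ)

/-- The spacelike boundary. -/
def bdry : completion h := DistQuot.mk _ none

/-- The canonical map to the completion. -/
def of (x : X) : completion h := DistQuot.mk _ (some x)

theorem τ_bdry_left (z : completion h) : (completion h).τ (bdry h) z = 0 := by
  obtain ⟨_ | _, rfl⟩ := DistQuot.mk_surjective _ z <;> rfl

theorem τ_bdry_right (z : completion h) : (completion h).τ z (bdry h) = 0 := by
  obtain ⟨_ | _, rfl⟩ := DistQuot.mk_surjective _ z <;> rfl

theorem eq_bdry_or_mem_range (z : completion h) : z = bdry h ∨ z ∈ range (of h) := by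
  obtain ⟨_ | x, rfl⟩ := DistQuot.mk_surjective _ z
  exacts [.inl rfl, .inr ⟨x, rfl⟩]

instance : CompactSpace (completion h) := by
  have := (completion h).isTimeSeparation.compactSpace (o := bdry h)
    fun z => ⟨τ_bdry_left h z, τ_bdry_right h z⟩
  rw [← (completion h).topology_eq] at this
  exact this

instance : TopologicalSpace.MetrizableSpace (completion h) := (completion h).metrizableSpace

instance : SecondCountableTopology (completion h) := (completion h).secondCountableTopology

instance : PolishSpace (completion h) := by
  let := TopologicalSpace.metrizableSpaceMetric (completion h)
  infer_instance

end completion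

/-! ### Embedding of a space into its completion. -/

namespace BLSpace

variable (X : BLSpace.{u})

/-- The inclusion of a bounded Lorentzian metric space into its completion. -/
def toCompletion (x : X) : completion X.isTimeSeparation := completion.of _ x

theorem toCompletion_injective : Function.Injective X.toCompletion := fun _ _ hxy =>
  ext_τ fun z => ⟨congrArg (fun a => (completion X.isTimeSeparation).τ a (X.toCompletion z)) hxy,
    congrArg (fun a => (completion X.isTimeSeparation).τ (X.toCompletion z) a) hxy⟩

theorem continuous_toCompletion : Continuous X.toCompletion := by
  have : @Continuous _ _ _ (initialTopology (completion X.isTimeSeparation).τ)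
      X.toCompletion := by
    refine continuous_induced_rng.2 (continuous_pi fun z => ?_)
    obtain rfl | ⟨z, rfl⟩ := completion.eq_bdry_or_mem_range _ z
    · simp only [Function.comp_def, completion.τ_bdry_left, completion.τ_bdry_right]
      exact continuous_const
    · exact (X.continuous_τ.comp (continuous_id.prodMk continuous_const)).prodMk
        (X.continuous_τ.comp (continuous_const.prodMk continuous_id))
  rw [← (completion X.isTimeSeparation).topology_eq] at this
  exact this

/-- Separations in `X` are restrictions of continuous separations in the completion, so the induced
topology is at least as fine as the initial one. -/
theorem isEmbedding_toCompletion : IsEmbedding X.toCompletion := by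
  refine ⟨⟨le_antisymm X.continuous_toCompletion.le_induced ?_⟩, X.toCompletion_injective⟩
  refine le_trans ?_ X.topology_eq.ge
  rw [← continuous_iff_le_induced]
  let := TopologicalSpace.induced X.toCompletion inferInstance
  have hc : Continuous X.toCompletion := continuous_induced_dom
  have hτ := (completion X.isTimeSeparation).continuous_τ
  exact continuous_pi fun z => (hτ.comp (hc.prodMk (continuous_const (y := X.toCompletion z)))).prodMk
    (hτ.comp ((continuous_const (y := X.toCompletion z)).prodMk hc))

instance : SecondCountableTopology X := X.isEmbedding_toCompletion.secondCountableTopology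

/-- The range misses at most the single point `bdry`, hence is Borel. -/
theorem measurableEmbedding_toCompletion : MeasurableEmbedding X.toCompletion := by
  refine X.isEmbedding_toCompletion.measurableEmbedding ?_
  by_cases hb : completion.bdry X.isTimeSeparation ∈ range X.toCompletion
  · have : range X.toCompletion = univ := eq_univ_of_forall fun z =>
      (completion.eq_bdry_or_mem_range _ z).elim (fun hz => hz ▸ hb) id
    rw [this]
    exact MeasurableSet.univ
  · have : range X.toCompletion = {completion.bdry X.isTimeSeparation}ᶜ := by
      ext z
      exact ⟨fun hz hz' => hb (hz' ▸ hz),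
        fun hz => (completion.eq_bdry_or_mem_range _ z).resolve_left hz⟩
    rw [this]
    exact (measurableSet_singleton _).compl

end BLSpace

namespace NormalizedBLMMS

variable (M : NormalizedBLMMS.{u})

instance : IsProbabilityMeasure M.m := M.isProbabilityMeasure

/-- The image measure on the Polish completion is a law of a map on the interval; a measurable left
inverse of the embedding brings that map back to `M`. -/
theorem Par_nonempty : M.Par.Nonempty := by
  have hj := M.space.measurableEmbedding_toCompletion
  have := Measure.isProbabilityMeasure_map (μ := M.m) hj.measurable.aemeasurable
  obtain ⟨x⟩ := M.space.nonempty
  have : Nonempty (completion M.space.isTimeSeparation).carrier := ⟨M.space.toCompletion x⟩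
  have : Nonempty M.space := ⟨x⟩
  obtain ⟨f, hf, hfm⟩ := Measure.exists_measurable_map_eq (M.m.map M.space.toCompletion)
  refine ⟨hj.invFun ∘ f, hj.measurable_invFun.comp hf, ?_⟩
  rw [← Measure.map_map hj.measurable_invFun hf, hfm,
    Measure.map_map hj.measurable_invFun hj.measurable, hj.leftInverse_invFun.id, Measure.map_id]

end NormalizedBLMMS

/-! ### Gluing of parametrizations -/

open ProbabilityTheory in
/-- Two maps on the unit interval with the same law agree up to measure preserving
reparametrizations. -/
theorem exists_measurePreserving_comp_ae_eq {X : Type*} [MeasurableSpace X]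
    [StandardBorelSpace X] {f g : unitInterval → X} (hf : Measurable f) (hg : Measurable g)
    (h : (volume : Measure unitInterval).map f = (volume : Measure unitInterval).map g) :
    ∃ h₁ h₂ : unitInterval → unitInterval, MeasurePreserving h₁ ∧ MeasurePreserving h₂ ∧
      f ∘ h₁ =ᵐ[volume] g ∘ h₂ := by
  let vol : Measure unitInterval := volume
  -- The conditional law of the parameter given `k = x` is concentrated on the fibre of `k` over
  -- `x`.
  have key : ∀ {k : unitInterval → X}, Measurable k →
      ∀ᵐ x ∂(vol.map k), ∀ᵐ s ∂(condDistrib id k vol x), k s = x := by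
    intro k hk
    refine Measure.ae_ae_of_ae_compProd (p := fun p : X × unitInterval => k p.2 = p.1) ?_
    rw [compProd_map_condDistrib measurable_id.aemeasurable, ae_map_iff (by fun_prop)]
    · simp
    · exact measurableSet_eq_fun (hk.comp measurable_snd) measurable_fst
  let κ := condDistrib id f vol
  let η := condDistrib id g vol
  let m := vol.map f
  have hκ : κ ∘ₘ m = vol := by
    have := condDistrib_comp_map (μ := vol) hf.aemeasurable measurable_id.aemeasurable
    rwa [Measure.map_id] at this
  have hη : η ∘ₘ m = vol := by
    have := condDistrib_comp_map (μ := vol) hg.aemeasurable measurable_id.aemeasurable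
    rwa [Measure.map_id, ← h] at this
  have : IsProbabilityMeasure m := Measure.isProbabilityMeasure_map hf.aemeasurable
  -- Draw a common value from `m`, then two parameters independently from the conditional laws over
  -- it. Both marginals are Lebesgue.
  let π : Measure (unitInterval × unitInterval) := (κ ×ₖ η) ∘ₘ m
  have hπ₁ : π.map Prod.fst = vol := by
    rw [Measure.map_comp _ _ measurable_fst, ← Kernel.fst_eq, Kernel.fst_prod, hκ]
  have hπ₂ : π.map Prod.snd = vol := by
    rw [Measure.map_comp _ _ measurable_snd, ← Kernel.snd_eq, Kernel.snd_prod, hη]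
  have hS : MeasurableSet {p : unitInterval × unitInterval | f p.1 = g p.2} :=
    measurableSet_eq_fun (hf.comp measurable_fst) (hg.comp measurable_snd)
  have hπ : ∀ᵐ p ∂π, f p.1 = g p.2 := by
    refine Measure.ae_comp_of_ae_ae hS ?_
    have kf := key hf
    have kg := key hg
    rw [← h] at kg
    filter_upwards [kf, kg] with x hx hx'
    rw [Kernel.prod_apply]
    filter_upwards [Measure.quasiMeasurePreserving_fst.ae hx,
      Measure.quasiMeasurePreserving_snd.ae hx'] with p hp hp'
    exact hp.trans hp'.symm
  -- The coupling is itself parametrized by the interval; the two coordinates of `k` are the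
  -- reparametrizations.
  obtain ⟨k, hk, hkπ⟩ := Measure.exists_measurable_map_eq π
  refine ⟨fun s => (k s).1, fun s => (k s).2, ⟨hk.fst, ?_⟩, ⟨hk.snd, ?_⟩, ?_⟩
  · rw [← hkπ, Measure.map_map measurable_fst hk] at hπ₁
    exact hπ₁
  · rw [← hkπ, Measure.map_map measurable_snd hk] at hπ₂
    exact hπ₂
  · rw [← hkπ, ae_map_iff hk.aemeasurable hS] at hπ
    exact hπ

/-! ### The box discrepancy -/

/-- The discrepancy of `u` and `v` is at most `ε` off a set of measure at most `ε`. -/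
def BoxLE (u v : unitInterval → unitInterval → ℝ) (ε : ℝ) : Prop :=
  0 < ε ∧ ∃ Q : Set unitInterval, MeasurableSet Q ∧ volume Q ≤ ENNReal.ofReal ε ∧
    ∀ s ∉ Q, ∀ t ∉ Q, |u s t - v s t| ≤ ε

namespace BoxLE

variable {u v w : unitInterval → unitInterval → ℝ} {ε δ : ℝ}

theorem mono (h : BoxLE u v ε) (hle : ε ≤ δ) : BoxLE u v δ := by
  obtain ⟨hε, Q, hQ, hQε, hd⟩ := h
  exact ⟨hε.trans_le hle, Q, hQ, hQε.trans (ENNReal.ofReal_le_ofReal hle),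
    fun s hs t ht => (hd s hs t ht).trans hle⟩

theorem symm (h : BoxLE u v ε) : BoxLE v u ε := by
  obtain ⟨hε, Q, hQ, hQε, hd⟩ := h
  exact ⟨hε, Q, hQ, hQε, fun s hs t ht => abs_sub_comm (u s t) _ ▸ hd s hs t ht⟩

theorem trans (h : BoxLE u v ε) (h' : BoxLE v w δ) : BoxLE u w (ε + δ) := by
  obtain ⟨hε, Q, hQ, hQε, hd⟩ := h
  obtain ⟨hδ, R, hR, hRδ, hd'⟩ := h'
  refine ⟨add_pos hε hδ, Q ∪ R, hQ.union hR, ?_, fun s hs t ht => ?_⟩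
  · rw [ENNReal.ofReal_add hε.le hδ.le]
    exact (measure_union_le _ _).trans (add_le_add hQε hRδ)
  · rw [mem_union, not_or] at hs ht
    exact (abs_sub_le _ (v s t) _).trans (add_le_add (hd s hs.1 t ht.1) (hd' s hs.2 t ht.2))

theorem comp (h : BoxLE u v ε) {k : unitInterval → unitInterval} (hk : MeasurePreserving k) :
    BoxLE (fun s t => u (k s) (k t)) (fun s t => v (k s) (k t)) ε := by
  obtain ⟨hε, Q, hQ, hQε, hd⟩ := h
  refine ⟨hε, k ⁻¹' Q, hk.measurable hQ, ?_, fun s hs t ht => hd _ hs _ ht⟩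
  rwa [hk.measure_preimage hQ.nullMeasurableSet]

theorem one (u v : unitInterval → unitInterval → ℝ) : BoxLE u v 1 :=
  ⟨one_pos, univ, MeasurableSet.univ, by simp, fun s hs => absurd (mem_univ s) hs⟩

theorem of_ae {p : unitInterval → Prop} (hp : ∀ᵐ s, p s)
    (h : ∀ s t, p s → p t → u s t = v s t) (hε : 0 < ε) : BoxLE u v ε := by
  obtain ⟨Q, hQ, hQm, hQ0⟩ := exists_measurable_superset_of_null (ae_iff.1 hp)
  have hpQ : ∀ s ∉ Q, p s := fun s hs => by
    by_contra hcon
    exact hs (hQ hcon)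
  refine ⟨hε, Q, hQm, by simp [hQ0], fun s hs t ht => ?_⟩
  rw [h s t (hpQ s hs) (hpQ t ht), sub_self, abs_zero]
  exact hε.le

end BoxLE

/-- Strict inequalities avoid the question whether the infimum is attained; the infimum runs over a
nonempty set by `BoxLE.one`. -/
theorem box_lt_iff {u v : unitInterval → unitInterval → ℝ} {r : ℝ} :
    box u v < r ↔ ∃ ε < r, BoxLE u v ε := by
  refine ⟨fun h => ?_, fun ⟨ε, hr, hε⟩ => lt_of_le_of_lt
    (csInf_le (s := {ε | BoxLE u v ε}) ⟨0, fun _ hx => hx.1.le⟩ hε) hr⟩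
  obtain ⟨ε, hε, hr⟩ := exists_lt_of_csInf_lt ⟨1, BoxLE.one u v⟩ h
  exact ⟨ε, hr, hε⟩

theorem box_nonneg (u v : unitInterval → unitInterval → ℝ) : 0 ≤ box u v :=
  Real.sInf_nonneg fun _ hx => hx.1.le

/-! ### The box distance -/

namespace NormalizedBLMMS

variable {M M' : NormalizedBLMMS.{u}}

theorem comp_mem_Par {ψ : unitInterval → M.space} (hψ : ψ ∈ M.Par) {k : unitInterval → unitInterval}
    (hk : MeasurePreserving k) : ψ ∘ k ∈ M.Par := by
  refine ⟨hψ.1.comp hk.measurable, ?_⟩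
  rw [← Measure.map_map hψ.1 hk.measurable, hk.map_eq, hψ.2]

/-- The gluing takes place in the Polish completion, and injectivity of the embedding returns it to
`M`. -/
theorem exists_comp_ae_eq {ψ φ : unitInterval → M.space} (hψ : ψ ∈ M.Par) (hφ : φ ∈ M.Par) :
    ∃ h₁ h₂ : unitInterval → unitInterval, MeasurePreserving h₁ ∧ MeasurePreserving h₂ ∧
      ψ ∘ h₁ =ᵐ[volume] φ ∘ h₂ := by
  have hj := M.space.measurableEmbedding_toCompletion
  obtain ⟨h₁, h₂, hh₁, hh₂, he⟩ := exists_measurePreserving_comp_ae_eq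
    (hj.measurable.comp hψ.1) (hj.measurable.comp hφ.1) (by
      rw [← Measure.map_map hj.measurable hψ.1, ← Measure.map_map hj.measurable hφ.1, hψ.2, hφ.2])
  refine ⟨h₁, h₂, hh₁, hh₂, ?_⟩
  filter_upwards [he] with s hs
  exact hj.injective hs

end NormalizedBLMMS

theorem LBox_nonneg (M M' : NormalizedBLMMS.{u}) : 0 ≤ LBox M M' :=
  Real.sInf_nonneg fun _ ⟨_, _, _, _, hr⟩ => hr ▸ box_nonneg _ _

/-- Existence of parametrizations matters here: the real infimum of an empty set would be `0`. -/
theorem LBox_lt_iff {M M' : NormalizedBLMMS.{u}} {r : ℝ} :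
    LBox M M' < r ↔ ∃ ψ ∈ M.Par, ∃ ψ' ∈ M'.Par, ∃ ε < r,
      BoxLE (pullback M.space.τ ψ) (pullback M'.space.τ ψ') ε := by
  constructor
  · intro h
    obtain ⟨ψ, hψ⟩ := M.Par_nonempty
    obtain ⟨ψ', hψ'⟩ := M'.Par_nonempty
    obtain ⟨_, ⟨φ, hφ, φ', hφ', rfl⟩, hlt⟩ := exists_lt_of_csInf_lt
      (by exact ⟨_, ψ, hψ, ψ', hψ', rfl⟩) h
    exact ⟨φ, hφ, φ', hφ', box_lt_iff.1 hlt⟩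
  · rintro ⟨ψ, hψ, ψ', hψ', h⟩
    refine lt_of_le_of_lt (csInf_le ⟨0, ?_⟩ ⟨ψ, hψ, ψ', hψ', rfl⟩) (box_lt_iff.2 h)
    rintro _ ⟨_, _, _, _, rfl⟩
    exact box_nonneg _ _

theorem LBox_comm (M M' : NormalizedBLMMS.{u}) : LBox M M' = LBox M' M := by
  have key : ∀ M M' : NormalizedBLMMS.{u}, LBox M M' ≤ LBox M' M := fun M M' =>
    le_of_forall_gt fun r hr => by
      obtain ⟨ψ, hψ, ψ', hψ', ε, hε, h⟩ := LBox_lt_iff.1 hr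
      exact LBox_lt_iff.2 ⟨ψ', hψ', ψ, hψ, ε, hε, h.symm⟩
  exact le_antisymm (key _ _) (key _ _)

theorem LBox_triangle (M₁ M₂ M₃ : NormalizedBLMMS.{u}) :
    LBox M₁ M₃ ≤ LBox M₁ M₂ + LBox M₂ M₃ := by
  refine le_of_forall_pos_lt_add fun r hr => ?_
  obtain ⟨ψ₁, hψ₁, ψ₂, hψ₂, ε, hε, h⟩ :=
    LBox_lt_iff.1 (lt_add_of_pos_right (LBox M₁ M₂) (show 0 < r / 3 by positivity))
  obtain ⟨φ₂, hφ₂, φ₃, hφ₃, δ, hδ, h'⟩ :=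
    LBox_lt_iff.1 (lt_add_of_pos_right (LBox M₂ M₃) (show 0 < r / 3 by positivity))
  obtain ⟨k, l, hk, hl, hkl⟩ := NormalizedBLMMS.exists_comp_ae_eq hψ₂ hφ₂
  -- The pull-backs agree off a null set, but `BoxLE` requires a positive bound; this takes the last
  -- third of `r`.
  have hmid : BoxLE (pullback M₂.space.τ (ψ₂ ∘ k)) (pullback M₂.space.τ (φ₂ ∘ l)) (r / 3) :=
    BoxLE.of_ae hkl (fun s t hs ht => by simp only [pullback, hs, ht]) (by positivity)
  exact LBox_lt_iff.2 ⟨ψ₁ ∘ k, NormalizedBLMMS.comp_mem_Par hψ₁ hk, φ₃ ∘ l,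
    NormalizedBLMMS.comp_mem_Par hφ₃ hl, _, by linarith,
    ((h.comp hk).trans hmid).trans (h'.comp hl)⟩

theorem LBox_self (M : NormalizedBLMMS.{u}) : LBox M M = 0 := by
  obtain ⟨ψ, hψ⟩ := M.Par_nonempty
  refine le_antisymm (le_of_forall_pos_lt_add fun r hr => ?_) (LBox_nonneg M M)
  exact LBox_lt_iff.2 ⟨ψ, hψ, ψ, hψ, r / 2, by linarith,
    BoxLE.of_ae (p := fun _ => True) (by simp) (fun _ _ _ _ => rfl) (by positivity)⟩

/-! ### Parametrizations of the distance quotient -/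

namespace NormalizedBLMMS

variable (M : NormalizedBLMMS.{u})

-- `bdQuot` unfolds to the completion of the restriction of `τ` to the support.
instance : CompactSpace M.bdQuot :=
  inferInstanceAs (CompactSpace (completion (M.space.isTimeSeparation.restrict
    M.m.isClosed_support)))

instance : PolishSpace M.bdQuot :=
  inferInstanceAs (PolishSpace (completion (M.space.isTimeSeparation.restrict
    M.m.isClosed_support)))

/-- The spacelike boundary of `bdQuot`. -/
def bdry : M.bdQuot := DistQuot.mk M.suppSep none

theorem τ_bdry_left (z : M.bdQuot) : M.bdQuot.τ M.bdry z = 0 :=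
  completion.τ_bdry_left (M.space.isTimeSeparation.restrict M.m.isClosed_support) z

theorem τ_bdry_right (z : M.bdQuot) : M.bdQuot.τ z M.bdry = 0 :=
  completion.τ_bdry_right (M.space.isTimeSeparation.restrict M.m.isClosed_support) z

theorem eq_bdry_or_mem_range_proj (z : M.bdQuot) : z = M.bdry ∨ z ∈ range M.proj :=
  completion.eq_bdry_or_mem_range (M.space.isTimeSeparation.restrict M.m.isClosed_support) z

/-- The extension of `proj` to the whole space which sends the complement of the support to the
spacelike boundary. -/
def toBdQuot : M.space → M.bdQuot := Function.extend ((↑) : M.m.support → M.space) M.proj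
  fun _ => M.bdry

theorem toBdQuot_coe (x : M.m.support) : M.toBdQuot x = M.proj x :=
  Subtype.val_injective.extend_apply _ _ _

theorem measurable_toBdQuot : Measurable M.toBdQuot :=
  (MeasurableEmbedding.subtype_coe M.m.isClosed_support.measurableSet).measurable_extend
    M.measurable_proj measurable_const

theorem ae_mem_support : ∀ᵐ x ∂M.m, x ∈ M.m.support := Measure.support_mem_ae

theorem map_toBdQuot : M.m.map M.toBdQuot = M.quotMeasure := by
  have h : M.proj = M.toBdQuot ∘ ((↑) : M.m.support → M.space) :=
    funext fun x => (M.toBdQuot_coe x).symm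
  rw [quotMeasure, h, ← Measure.map_map M.measurable_toBdQuot measurable_subtype_coe,
    map_comap_subtype_coe M.m.isClosed_support.measurableSet,
    Measure.restrict_eq_self_of_ae_mem M.ae_mem_support]

instance : IsProbabilityMeasure M.quotMeasure :=
  M.map_toBdQuot ▸ Measure.isProbabilityMeasure_map M.measurable_toBdQuot.aemeasurable

theorem τ_toBdQuot {x y : M.space} (hx : x ∈ M.m.support) (hy : y ∈ M.m.support) :
    M.bdQuot.τ (M.toBdQuot x) (M.toBdQuot y) = M.space.τ x y := by
  rw [M.toBdQuot_coe ⟨x, hx⟩, M.toBdQuot_coe ⟨y, hy⟩]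
  rfl

variable {M} {M' : NormalizedBLMMS.{u}}

theorem ae_mem_support_of_mem_Par {ψ : unitInterval → M.space} (hψ : ψ ∈ M.Par) :
    ∀ᵐ s, ψ s ∈ M.m.support :=
  ae_of_ae_map hψ.1.aemeasurable (hψ.2 ▸ M.ae_mem_support)

theorem map_toBdQuot_comp {ψ : unitInterval → M.space} (hψ : ψ ∈ M.Par) :
    (volume : Measure unitInterval).map (M.toBdQuot ∘ ψ) = M.quotMeasure := by
  rw [← Measure.map_map M.measurable_toBdQuot hψ.1, hψ.2, map_toBdQuot]

/-- A parametrization leaves the support only on a null set, so passing to the compact distance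
quotient costs arbitrarily little. -/
theorem boxLE_toBdQuot {ψ : unitInterval → M.space} (hψ : ψ ∈ M.Par) {ε : ℝ} (hε : 0 < ε) :
    BoxLE (pullback M.bdQuot.τ (M.toBdQuot ∘ ψ)) (pullback M.space.τ ψ) ε :=
  BoxLE.of_ae (ae_mem_support_of_mem_Par hψ) (fun _ _ hs ht => M.τ_toBdQuot hs ht) hε

theorem Isomorphic.LBox_eq_zero (h : Isomorphic M M') : LBox M M' = 0 := by
  obtain ⟨ι, hι, hτ, hm⟩ := h
  obtain ⟨ψ, hψ⟩ := M.Par_nonempty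
  obtain ⟨ψ', hψ'⟩ := M'.Par_nonempty
  have hq := M.measurable_toBdQuot.comp hψ.1
  -- Both maps into `M'.bdQuot` have law `M'.quotMeasure`, so they can be glued there.
  obtain ⟨k, l, hk, hl, hkl⟩ := exists_measurePreserving_comp_ae_eq (hι.comp hq)
    (M'.measurable_toBdQuot.comp hψ'.1) (by
      rw [← Measure.map_map hι hq, map_toBdQuot_comp hψ, map_toBdQuot_comp hψ', hm])
  have hψk := comp_mem_Par hψ hk
  have hψl := comp_mem_Par hψ' hl
  refine le_antisymm (le_of_forall_pos_lt_add fun r hr => ?_) (LBox_nonneg M M')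
  refine LBox_lt_iff.2 ⟨ψ ∘ k, hψk, ψ' ∘ l, hψl, r / 4 + r / 4 + r / 4, by linarith,
    ((boxLE_toBdQuot hψk (by positivity)).symm.trans ?_).trans
      (boxLE_toBdQuot hψl (by positivity))⟩
  refine BoxLE.of_ae hkl (fun s t hs ht => ?_) (by positivity)
  simp only [pullback, hτ]
  exact congrArg₂ M'.bdQuot.τ hs ht

/-! ### Limits of couplings -/

/-- Push-forward under a continuous map is weakly continuous and weak limits are unique; used to
keep the marginals of couplings in the limit. -/
theorem map_eq_of_tendsto {ι Z X : Type*} [TopologicalSpace Z] [MeasurableSpace Z] [BorelSpace Z]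
    [TopologicalSpace X] [MeasurableSpace X] [BorelSpace X] [HasOuterApproxClosed X]
    {l : Filter ι} [l.NeBot] {P : ι → ProbabilityMeasure Z} {π : ProbabilityMeasure Z}
    (h : Tendsto P l (𝓝 π)) {p : Z → X} (hp : Continuous p) {μ : Measure X}
    (hμ : ∀ i, (P i : Measure Z).map p = μ) : (π : Measure Z).map p = μ := by
  obtain ⟨i₀⟩ := l.nonempty_of_neBot
  have ht := ProbabilityMeasure.tendsto_map_of_tendsto_of_continuous P π h hp
  have hc : ∀ i, (P i).map hp.measurable.aemeasurable = (P i₀).map hp.measurable.aemeasurable :=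
    fun i => Subtype.ext ((hμ i).trans (hμ i₀).symm)
  simp only [hc] at ht
  have := congrArg ProbabilityMeasure.toMeasure (tendsto_nhds_unique ht tendsto_const_nhds)
  exact this.trans (hμ i₀)

/-- The coupling is a weak limit of the joint laws of `f` and `g` as the discrepancy bound tends to
zero. A mismatch at two support points would persist on neighbourhoods of positive mass, too large
to be hidden in exceptional sets of vanishing measure. -/
theorem exists_coupling {X Y : BLSpace.{u}} [CompactSpace X] [CompactSpace Y]
    {μ : Measure X} {ν : Measure Y}
    (h : ∀ ε : ℝ, 0 < ε → ∃ (f : unitInterval → X) (g : unitInterval → Y), Measurable f ∧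
      Measurable g ∧ (volume : Measure unitInterval).map f = μ ∧
      (volume : Measure unitInterval).map g = ν ∧ BoxLE (pullback X.τ f) (pullback Y.τ g) ε) :
    ∃ π : Measure (X × Y), π.map Prod.fst = μ ∧ π.map Prod.snd = ν ∧
      ∀ p ∈ π.support, ∀ q ∈ π.support, X.τ p.1 q.1 = Y.τ p.2 q.2 := by
  have := X.metrizableSpace
  have := Y.metrizableSpace
  let := TopologicalSpace.metrizableSpaceMetric (X × Y)
  let := TopologicalSpace.metrizableSpaceMetric X
  let := TopologicalSpace.metrizableSpaceMetric Y
  choose f g hf hg hfμ hgν hfg using fun n : ℕ => h (1 / ((n : ℝ) + 1)) Nat.one_div_pos_of_nat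
  have hfgm : ∀ n, Measurable fun s => (f n s, g n s) := fun n => (hf n).prodMk (hg n)
  let P : ℕ → ProbabilityMeasure (X × Y) := fun n =>
    ⟨(volume : Measure unitInterval).map fun s => (f n s, g n s),
      Measure.isProbabilityMeasure_map (hfgm n).aemeasurable⟩
  let U : Ultrafilter ℕ := Ultrafilter.of atTop
  have hU : (U : Filter ℕ) ≤ atTop := Ultrafilter.of_le atTop
  -- Probability measures on the compact metrizable product form a compact space; the ultrafilter
  -- replaces a convergent subsequence.
  obtain ⟨π, -, hπ⟩ := isCompact_univ.ultrafilter_le_nhds' (U.map P) univ_mem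
  have hlim : Tendsto P U (𝓝 π) := hπ
  refine ⟨π, ?_, ?_, ?_⟩
  · exact map_eq_of_tendsto hlim continuous_fst fun n =>
      (Measure.map_map measurable_fst (hfgm n)).trans (hfμ n)
  · exact map_eq_of_tendsto hlim continuous_snd fun n =>
      (Measure.map_map measurable_snd (hfgm n)).trans (hgν n)
  · intro p hp q hq
    by_contra hne
    have hpos : 0 < |X.τ p.1 q.1 - Y.τ p.2 q.2| := abs_pos.2 (sub_ne_zero.2 hne)
    obtain ⟨δ, hδ, hδ'⟩ := exists_between hpos
    have hcont : Continuous fun r : (X × Y) × X × Y =>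
        |X.τ r.1.1 r.2.1 - Y.τ r.1.2 r.2.2| :=
      ((X.continuous_τ.comp (continuous_fst.fst.prodMk continuous_snd.fst)).sub
        (Y.continuous_τ.comp (continuous_fst.snd.prodMk continuous_snd.snd))).abs
    obtain ⟨V, W, hV, hpV, hW, hqW, hVW⟩ := mem_nhds_prod_iff'.1
      (hcont.continuousAt.eventually (eventually_gt_nhds hδ') : _ ∈ 𝓝 (p, q))
    -- By the portmanteau theorem `V` eventually has `P n`-mass above a fixed `c > 0`, while
    -- admissible sets `Q` have measure below `c`; so `Q` cannot cover the preimage of `V`.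
    have hmeet : ∀ V : Set (X × Y), IsOpen V → 0 < (π : Measure (X × Y)) V →
        ∀ᶠ n : ℕ in (U : Filter ℕ), ∀ Q : Set unitInterval,
          volume Q ≤ ENNReal.ofReal (1 / ((n : ℝ) + 1)) → ∃ s ∉ Q, (f n s, g n s) ∈ V := by
      intro V hV hpos
      obtain ⟨c, hc, hcV⟩ := exists_between
        (hpos.trans_le (ProbabilityMeasure.le_liminf_measure_open_of_tendsto hlim hV))
      have h0 : Tendsto (fun n : ℕ => ENNReal.ofReal (1 / ((n : ℝ) + 1))) U (𝓝 0) := by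
        have := ENNReal.tendsto_ofReal (tendsto_one_div_add_atTop_nhds_zero_nat (𝕜 := ℝ))
        rw [ENNReal.ofReal_zero] at this
        exact this.mono_left hU
      filter_upwards [eventually_lt_of_lt_liminf hcV, h0.eventually (eventually_lt_nhds hc)]
        with n hn hnc Q hQ
      by_contra! hcon
      have hsub : (fun s => (f n s, g n s)) ⁻¹' V ⊆ Q := fun s hs => by
        by_contra hsQ
        exact hcon s hsQ hs
      have hn' : c < volume ((fun s => (f n s, g n s)) ⁻¹' V) := by
        rwa [← Measure.map_apply (hfgm n) hV.measurableSet]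
      exact (hn'.trans_le ((measure_mono hsub).trans hQ)).not_gt hnc
    have hsmall : ∀ᶠ n : ℕ in (U : Filter ℕ), 1 / ((n : ℝ) + 1) < δ :=
      hU ((tendsto_one_div_add_atTop_nhds_zero_nat (𝕜 := ℝ)).eventually (eventually_lt_nhds hδ))
    obtain ⟨n, hnV, hnW, hnδ⟩ := ((hmeet V hV
      ((Measure.mem_support_iff_forall p).1 hp V (hV.mem_nhds hpV))).and ((hmeet W hW
        ((Measure.mem_support_iff_forall q).1 hq W (hW.mem_nhds hqW))).and hsmall)).exists
    obtain ⟨-, Q, -, hQ, hd⟩ := hfg n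
    obtain ⟨s, hs, hsV⟩ := hnV Q hQ
    obtain ⟨t, ht, htW⟩ := hnW Q hQ
    have h1 : δ < |X.τ (f n s) (f n t) - Y.τ (g n s) (g n t)| :=
      hVW (mk_mem_prod hsV htW)
    exact (h1.trans_le (hd s hs t ht)).not_gt hnδ

/-- The image of the support is compact and has full `quotMeasure`. If it missed `proj x`, some
neighbourhood of `x` in `M` would be null, against `x` lying in the support of `m`. -/
theorem exists_mem_support_eq_proj {Z : Type*} [TopologicalSpace Z] [CompactSpace Z]
    [SecondCountableTopology Z] [MeasurableSpace Z] [BorelSpace Z] {π : Measure Z}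
    {p : Z → M.bdQuot} (hp : Continuous p) (h : π.map p = M.quotMeasure) (x : M.m.support) :
    ∃ z ∈ π.support, p z = M.proj x := by
  have hK : IsClosed (p '' π.support) := (π.isClosed_support.isCompact.image hp).isClosed
  have h0 : M.quotMeasure (p '' π.support)ᶜ = 0 := by
    rw [← h, Measure.map_apply hp.measurable hK.measurableSet.compl]
    refine measure_mono_null (fun z hz hz' => hz ⟨z, hz', rfl⟩) (Measure.measure_compl_support)
  by_contra hx
  obtain ⟨U, hU, hUx⟩ := isOpen_induced_iff.1 (hK.isOpen_compl.preimage M.continuous_proj)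
  have hxU : (x : M.space) ∈ U := by
    have : x ∈ M.proj ⁻¹' (p '' π.support)ᶜ := hx
    rwa [← hUx] at this
  refine ((Measure.mem_support_iff_forall (x : M.space)).1 x.2 U (hU.mem_nhds hxU)).ne' ?_
  rw [← map_toBdQuot, Measure.map_apply M.measurable_toBdQuot hK.measurableSet.compl] at h0
  refine measure_mono_null (t := M.toBdQuot ⁻¹' (p '' π.support)ᶜ ∪ M.m.supportᶜ) ?_
    (measure_union_null h0 Measure.measure_compl_support)
  intro y hy
  by_cases hys : y ∈ M.m.support
  · refine .inl ?_
    have : (⟨y, hys⟩ : M.m.support) ∈ M.proj ⁻¹' (p '' π.support)ᶜ := by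
      rw [← hUx]
      exact hy
    rw [mem_preimage, M.toBdQuot_coe ⟨y, hys⟩]
    exact this
  · exact .inr hys

/-! ### Isomorphy as vanishing distance. -/

theorem isomorphic_of_LBox_eq_zero (h : LBox M M' = 0) : Isomorphic M M' := by
  obtain ⟨π, hπ, hπ', hτ⟩ := exists_coupling (X := M.bdQuot) (Y := M'.bdQuot)
    (μ := M.quotMeasure) (ν := M'.quotMeasure) fun ε hε => by
      obtain ⟨ψ, hψ, ψ', hψ', δ, hδ, hd⟩ :=
        LBox_lt_iff.1 (h.trans_lt (show 0 < ε / 3 by positivity))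
      exact ⟨_, _, M.measurable_toBdQuot.comp hψ.1, M'.measurable_toBdQuot.comp hψ'.1,
        map_toBdQuot_comp hψ, map_toBdQuot_comp hψ',
        (((boxLE_toBdQuot hψ (ε := ε / 3) (by positivity)).trans hd).trans
          (boxLE_toBdQuot hψ' (ε := ε / 3) (by positivity)).symm).mono (by linarith)⟩
  -- The boundaries may lie outside the projections of the support, so their pair is added; it
  -- respects the separations because they vanish at the boundaries.
  let R : M.bdQuot → M'.bdQuot → Prop := fun x y =>
    (x, y) ∈ π.support ∨ x = M.bdry ∧ y = M'.bdry
  have hR : ∀ x y x₁ y₁, R x y → R x₁ y₁ → M.bdQuot.τ x x₁ = M'.bdQuot.τ y y₁ := by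
    rintro x y x₁ y₁ (hp | ⟨rfl, rfl⟩) (hq | ⟨rfl, rfl⟩)
    · exact hτ _ hp _ hq
    · rw [τ_bdry_right, τ_bdry_right]
    all_goals rw [τ_bdry_left, τ_bdry_left]
  have hleft : ∀ x, ∃ y, R x y := fun x => by
    obtain rfl | ⟨x, rfl⟩ := M.eq_bdry_or_mem_range_proj x
    · exact ⟨_, .inr ⟨rfl, rfl⟩⟩
    · obtain ⟨⟨_, y⟩, hz, rfl⟩ := exists_mem_support_eq_proj continuous_fst hπ x
      exact ⟨y, .inl hz⟩
  have hright : ∀ y, ∃ x, R x y := fun y => by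
    obtain rfl | ⟨y, rfl⟩ := M'.eq_bdry_or_mem_range_proj y
    · exact ⟨_, .inr ⟨rfl, rfl⟩⟩
    · obtain ⟨⟨x, _⟩, hz, rfl⟩ := exists_mem_support_eq_proj continuous_snd hπ' y
      exact ⟨x, .inl hz⟩
  choose ι hι using hleft
  -- Every `z` has a partner under `R`, so two partners of `x` have the same separations to all
  -- points and coincide by point distinction.
  have huniq : ∀ x y, R x y → ι x = y := fun x y hxy => BLSpace.ext_τ fun z => by
    obtain ⟨w, hw⟩ := hright z
    exact ⟨(hR _ _ _ _ (hι x) hw).symm.trans (hR _ _ _ _ hxy hw),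
      (hR _ _ _ _ hw (hι x)).symm.trans (hR _ _ _ _ hw hxy)⟩
  have hιτ : ∀ x y, M.bdQuot.τ x y = M'.bdQuot.τ (ι x) (ι y) := fun x y =>
    hR _ _ _ _ (hι x) (hι y)
  have hιm : Measurable ι := (BLSpace.continuous_of_preserves _
    (fun y => (hright y).imp fun x hx => huniq x y hx) hιτ).measurable
  refine ⟨ι, hιm, hιτ, ?_⟩
  rw [← hπ, Measure.map_map hιm measurable_fst, ← hπ']
  refine Measure.map_congr ?_
  -- Almost every point of the coupling lies on the graph of `ι`, which therefore carries one
  -- marginal to the other.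
  filter_upwards [Measure.support_mem_ae (μ := π)] with z hz
  exact huniq _ _ (.inl hz)

theorem LBox_eq_zero_iff : LBox M M' = 0 ↔ Isomorphic M M' :=
  ⟨isomorphic_of_LBox_eq_zero, Isomorphic.LBox_eq_zero⟩

/-- All three properties are inherited from the pseudometric `LBox`; symmetry in particular needs no
explicit inverse of an isomorphism. -/
theorem isomorphic_equivalence : Equivalence Isomorphic.{u} where
  refl M := LBox_eq_zero_iff.1 (LBox_self M)
  symm h := LBox_eq_zero_iff.1 ((LBox_comm _ _).trans h.LBox_eq_zero)
  trans h h' := LBox_eq_zero_iff.1 (le_antisymm ((LBox_triangle _ _ _).trans_eq (by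
    rw [h.LBox_eq_zero, h'.LBox_eq_zero, add_zero])) (LBox_nonneg _ _))

theorem Isomorphic.LBox_congr {N N' : NormalizedBLMMS.{u}} (h : Isomorphic M N)
    (h' : Isomorphic M' N') : LBox M M' = LBox N N' := by
  have key : ∀ {M M' N N' : NormalizedBLMMS.{u}}, Isomorphic M N → Isomorphic M' N' →
      LBox M M' ≤ LBox N N' := fun {M M' N N'} h h' => by
    have h₁ := LBox_triangle M N M'
    have h₂ := LBox_triangle N N' M'
    rw [h.LBox_eq_zero] at h₁
    rw [(isomorphic_equivalence.symm h').LBox_eq_zero] at h₂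
    linarith
  exact le_antisymm (key h h')
    (key (isomorphic_equivalence.symm h) (isomorphic_equivalence.symm h'))

end NormalizedBLMMS

end LorentzBox

end

/-! ### The metric on isomorphism classes. -/

theorem theorem4p13 :
    (∀ M : LorentzBox.NormalizedBLMMS.{u}, M.Par.Nonempty) ∧
    ∃ hiso : Equivalence LorentzBox.NormalizedBLMMS.Isomorphic.{u},
      ∃ d : MetricSpace (Quotient
          (⟨LorentzBox.NormalizedBLMMS.Isomorphic.{u}, hiso⟩ :
            Setoid LorentzBox.NormalizedBLMMS.{u})),
        ∀ M M' : LorentzBox.NormalizedBLMMS.{u},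
          d.dist (Quotient.mk _ M) (Quotient.mk _ M') = LorentzBox.LBox M M' := by
  refine ⟨fun M => M.Par_nonempty, LorentzBox.NormalizedBLMMS.isomorphic_equivalence, ?_⟩
  let S : Setoid LorentzBox.NormalizedBLMMS.{u} :=
    ⟨LorentzBox.NormalizedBLMMS.Isomorphic, LorentzBox.NormalizedBLMMS.isomorphic_equivalence⟩
  let D : Quotient S → Quotient S → ℝ :=
    Quotient.lift₂ LorentzBox.LBox fun _ _ _ _ h h' => h.LBox_congr h'
  refine ⟨{ dist := D, dist_self := ?_, dist_comm := ?_, dist_triangle := ?_,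
            eq_of_dist_eq_zero := ?_ }, fun _ _ => rfl⟩
  · rintro ⟨M⟩
    exact LorentzBox.LBox_self M
  · rintro ⟨M⟩ ⟨M'⟩
    exact LorentzBox.LBox_comm M M'
  · rintro ⟨M₁⟩ ⟨M₂⟩ ⟨M₃⟩
    exact LorentzBox.LBox_triangle M₁ M₂ M₃
  · rintro ⟨M⟩ ⟨M'⟩ h
    exact Quotient.sound (LorentzBox.NormalizedBLMMS.isomorphic_of_LBox_eq_zero h)
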